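/- **Setting.** Let $n,k,r,m$ be nonnegative integers and $$D=\{x\in\mathbb R^n : x^L\le x\le x^U,\ g(x)\le 0\},\qquad x^L,x^U\in\mathbb R^n,\quad g=(g_1,\dots,g_r),$$ and let $f=(f_1,\dots,f_k)$, where all $g_l$ and $f_j$ are real-valued and Lipschitz continuous on $[x^L,x^U]$. Let $t^L,t^U\in\mathbb R^k$ be bounds with $t^L\le f(x)\le t^U$ for all $x\in D$. Let $M_1,\dots,M_m:\mathbb R^k\to\mathbb R$ be multilinear, i.e. affine in each variable when the other variables are fixed. Put $$\operatorname{graph}(f)=\{(x,t): x\in D,\ t=f(x)\},\qquad \mathcal G=\{(x,\mu)\in\mathbb R^{n+m}: x\in D,\ \mu_i=M_i(f_1(x),\dots,f_k(x))\ \text{for } i=1,\dots,m\}.$$ **Algorithm.** Inside the box $B_0=[x^L,x^U]\times[t^L,t^U]\subset\mathbb R^{n+k}$, the set $\operatorname{graph}(f)$ is described by $G(x,t)\le 0$, where $G(x,t)=(g(x),\,t-f(x),\,f(x)-t)$. Let $\mathtt{range}$ be a procedure that assigns to each nonempty sub-box $B$ of $B_0$ a box $[G^L,G^U]\supseteq G(B)$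 whose diameter tends to $0$, uniformly in $B$, as $\operatorname{diam} B\to0$ (for example $G_j(c)\pm K\max_{z\in B}\|z-c\|$ with $c\in B$ and $K$ a Lipschitz constant of all $G_j$). Given a tolerance $\epsilon>0$, start with a stack containing only $B_0$. While the stack is nonempty, pop a box $B$ and compute $[G^L,G^U]=\mathtt{range}(B)$. If $G^U_j\le 0$ for all $j$, collect $B$. Otherwise, if $G^L_j>0$ for some $j$, discard $B$. Otherwise, if $\operatorname{diam} B\ge\epsilon$, push the $2^{n+k}$ sub-boxes of $B$ obtained by bisecting every edge. Otherwise, collect $B$. When the stack is empty, return the union $\mathcal H$ of the collected boxes. **Corner points.** Group the coordinates of $\mathbb R^{n+k}$ into blocks so that no block contains two of the $k$ coordinates $t_j$ (for example, every coordinate is a block of its own), and view $\mathbb R^{n+k}$ as the corresponding product. A set is axis-aligned if it is a finite union of products of polytopes, one polytope for each block. A corner point of $\mathcal H$ is a point $v\in\mathcal H$ such that, for every block $b$, $v$ is an extreme point of the convex hull of $\{z\in\mathcal H: z \text{ agrees with } v \text{ in all blocks other than } b\}$. Write $\operatorname{corner}(\mathcal H)$ for the set of corner points. **Theorem.** For every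 $\nu\in\{1,2,\dots\}$ the algorithm with tolerance $\epsilon=1/\nu$ terminates after finitely many steps. Let $\mathcal H^\nu$ be the region it returns and $$\mathcal Q^\nu=\{(x,\mu)\in\mathbb R^{n+m} : (x,t)\in\operatorname{corner}(\mathcal H^\nu),\ \mu_i=M_i(t)\ \text{for } i=1,\dots,m\}.$$ Then: 1. for every $\nu$, $\mathcal H^\nu$ is axis-aligned and $\operatorname{graph}(f)\subseteq\mathcal H^\nu$; 2. for every $\nu$, $\mathcal Q^\nu$ is finite and $\operatorname{conv}(\mathcal Q^\nu)$ is a polyhedral relaxation of $\mathcal G$, that is, it is the solution set of finitely many linear inequalities and contains $\mathcal G$; 3. $\operatorname{conv}(\mathcal Q^\nu)\to\operatorname{conv}(\mathcal G)$ in the (Euclidean) Hausdorff distance as $\nu\to\infty$. Here the Hausdorff distance takes values in $[0,\infty]$; it is $0$ between two empty sets and $\infty$ between an empty and a nonempty set. -/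

import Mathlib

open Set Filter Topology

open scoped NNReal ENNReal

noncomputable section

/-! ### Boxes -/

/-- A closed box `[lo, hi]` in `ℝ^ι`, given by its vectors of lower and upper bounds. -/
structure AABox (ι : Type) where
  /-- lower bounds -/
  lo : ι → ℝ
  /-- upper bounds -/
  hi : ι → ℝ

namespace AABox

variable {ι : Type}

/-- The set of points of a box, in Euclidean space. -/
def toSet (B : AABox ι) : Set (EuclideanSpace ℝ ι) :=
  {x | ∀ i, B.lo i ≤ x i ∧ x i ≤ B.hi i}

/-- The diameter of a box in the Euclidean norm. -/
def diam [Fintype ι] (B : AABox ι) : ℝ := Metric.diam B.toSet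

/-- The sub-box of `B` that in direction `i` is the upper half of `B` if `s i` is true, and the
lower half otherwise. -/
def child (B : AABox ι) (s : ι → Bool) : AABox ι where
  lo i := if s i then (B.lo i + B.hi i) / 2 else B.lo i
  hi i := if s i then B.hi i else (B.lo i + B.hi i) / 2

/-- The `2 ^ |ι|` sub-boxes obtained by bisecting every edge of `B`, in some order. -/
def split [Fintype ι] [DecidableEq ι] (B : AABox ι) : List (AABox ι) :=
  (Finset.univ : Finset (ι → Bool)).toList.map B.child

end AABox

/-! ### Range procedures -/

/-- `range` is a range procedure for `G` on the box `B₀`: to every nonempty sub-box `B` of `B₀` it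
assigns a box that contains the image `G(B)` (enclosure), and the diameter of that box tends to
zero as the diameter of `B` tends to zero (consistency). -/
def IsRangeProcedure {ι κ : Type} [Fintype ι] [Fintype κ]
    (G : EuclideanSpace ℝ ι → EuclideanSpace ℝ κ) (B₀ : AABox ι)
    (range : AABox ι → AABox κ) : Prop :=
  (∀ B : AABox ι, B.toSet.Nonempty → B.toSet ⊆ B₀.toSet →
    ∀ x ∈ B.toSet, G x ∈ (range B).toSet) ∧
  ∀ δ > (0 : ℝ), ∃ η > (0 : ℝ), ∀ B : AABox ι, B.toSet.Nonempty → B.toSet ⊆ B₀.toSet →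
    B.diam < η → (range B).diam < δ

/-- The enclosure `[G(c) - K max_{x ∈ B} ‖x - c‖, G(c) + K max_{x ∈ B} ‖x - c‖]` of `G(B)`, for a
Lipschitz constant `K` of the components of `G` and a point `c = c(B)` of `B`. -/
def lipschitzRange {ι κ : Type} [Fintype ι]
    (G : EuclideanSpace ℝ ι → EuclideanSpace ℝ κ) (K : ℝ≥0)
    (c : AABox ι → EuclideanSpace ℝ ι) (B : AABox ι) : AABox κ where
  lo j := G (c B) j - K * sSup ((fun x => ‖x - c B‖) '' B.toSet)
  hi j := G (c B) j + K * sSup ((fun x => ‖x - c B‖) '' B.toSet)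

/-! ### The interval-subdivision algorithm -/

/-- One pass of the main loop of the algorithm for the system `G(x) ≤ 0` with tolerance `ε`, where
`range` encloses the values of `G`. A state consists of the stack of unprocessed boxes and the list
of boxes collected so far; a state with an empty stack is final. -/
def subdivisionStep {ι κ : Type} [Fintype ι] [DecidableEq ι]
    (range : AABox ι → AABox κ) (ε : ℝ) :
    List (AABox ι) × List (AABox ι) → List (AABox ι) × List (AABox ι) :=
  open Classical in fun S =>
    match S with
    | ([], R) => ([], R)
    | (B :: U, R) =>
      if ∀ j, (range B).hi j ≤ 0 then (U, B :: R)
      else if ∃ j, 0 < (range B).lo j then (U, R)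
      else if ε ≤ B.diam then (B.split ++ U, R)
      else (U, B :: R)

/-- The algorithm, started with the single box `B₀`, terminates after finitely many passes and
returns the region `H`, the union of the collected boxes. -/
def SubdivisionReturns {ι κ : Type} [Fintype ι] [DecidableEq ι]
    (range : AABox ι → AABox κ) (ε : ℝ) (B₀ : AABox ι) (H : Set (EuclideanSpace ℝ ι)) : Prop :=
  ∃ (N : ℕ) (R : List (AABox ι)),
    (subdivisionStep range ε)^[N] ([B₀], []) = ([], R) ∧ H = ⋃ B ∈ R, B.toSet

/-! ### Polytopes, polyhedra, axis-aligned regions, corner points -/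

/-- A polytope: the convex hull of finitely many points. -/
def IsPolytope {ι : Type} (P : Set (EuclideanSpace ℝ ι)) : Prop :=
  ∃ V : Set (EuclideanSpace ℝ ι), V.Finite ∧ P = convexHull ℝ V

/-- A polyhedron: the solution set of finitely many (non-strict) linear inequalities. -/
def IsPolyhedron {ι : Type} [Fintype ι] (P : Set (EuclideanSpace ℝ ι)) : Prop :=
  ∃ (N : ℕ) (a : Fin N → ι → ℝ) (b : Fin N → ℝ), P = {x | ∀ l, ∑ i, a l i * x i ≤ b l}

/-- The part of a vector belonging to the block `b`, for a grouping `blk` of the coordinates into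
blocks; this identifies `ℝ^ι` with the product over `b` of the spaces `ℝ^{n_b}`. -/
def blockPart {ι : Type} {q : ℕ} (blk : ι → Fin q) (b : Fin q) (x : EuclideanSpace ℝ ι) :
    EuclideanSpace ℝ {i // blk i = b} :=
  WithLp.toLp 2 fun i => x i.1

/-- `H ⊆ ℝ^{n_1} × ⋯ × ℝ^{n_q}` is axis-aligned: a finite union of products of polytopes. -/
def IsAxisAligned {ι : Type} {q : ℕ} (blk : ι → Fin q) (H : Set (EuclideanSpace ℝ ι)) : Prop :=
  ∃ (N : ℕ) (P : Fin N → ∀ b : Fin q, Set (EuclideanSpace ℝ {i // blk i = b})),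
    (∀ a b, IsPolytope (P a b)) ∧ H = ⋃ a, {x | ∀ b, blockPart blk b x ∈ P a b}

/-- The corner points of `H ⊆ ℝ^{n_1} × ⋯ × ℝ^{n_q}`: the points `v` of `H` such that for every
block `b` the point `v` is extreme in the convex hull of the slice of `H` through `v` in which all
the blocks other than `b` are fixed. -/
def cornerPoints {ι : Type} {q : ℕ} (blk : ι → Fin q) (H : Set (EuclideanSpace ℝ ι)) :
    Set (EuclideanSpace ℝ ι) :=
  {v | v ∈ H ∧ ∀ b : Fin q,
    v ∈ (convexHull ℝ {x | x ∈ H ∧ ∀ i, blk i ≠ b → x i = v i}).extremePoints ℝ}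

/-! ### Multilinear compositions -/

/-- `M : ℝ^k → ℝ` is a multilinear function: affine in each variable when the others are fixed. -/
def IsMultilinear {k : ℕ} (M : (Fin k → ℝ) → ℝ) : Prop :=
  ∀ (t : Fin k → ℝ) (j : Fin k), ∃ a b : ℝ, ∀ s : ℝ, M (Function.update t j s) = a * s + b

/-- The `x`-part of a point `(x, t)` of `ℝ^n × ℝ^k`. -/
def xPart {n k : ℕ} (z : EuclideanSpace ℝ (Fin n ⊕ Fin k)) : EuclideanSpace ℝ (Fin n) :=
  WithLp.toLp 2 fun i => z (Sum.inl i)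

/-- The `t`-part of a point `(x, t)` of `ℝ^n × ℝ^k`. -/
def tPart {n k : ℕ} (z : EuclideanSpace ℝ (Fin n ⊕ Fin k)) : Fin k → ℝ :=
  fun j => z (Sum.inr j)

/-- The domain `D = {x | xL ≤ x ≤ xU, g(x) ≤ 0}`. -/
def feasibleSet {n r : ℕ} (xL xU : Fin n → ℝ) (g : Fin r → EuclideanSpace ℝ (Fin n) → ℝ) :
    Set (EuclideanSpace ℝ (Fin n)) :=
  {x | x ∈ (AABox.mk xL xU).toSet ∧ ∀ l, g l x ≤ 0}

/-- The graph `{(x, t) | x ∈ D, t_j = f_j(x) for all j}` of `f` over `D`. -/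
def graphOver {n k : ℕ} (D : Set (EuclideanSpace ℝ (Fin n)))
    (f : Fin k → EuclideanSpace ℝ (Fin n) → ℝ) : Set (EuclideanSpace ℝ (Fin n ⊕ Fin k)) :=
  {z | xPart z ∈ D ∧ ∀ j, tPart z j = f j (xPart z)}

/-- The constraint functions `g_l(x)`, `t_j - f_j(x)` and `f_j(x) - t_j` of the system
`g(x) ≤ 0, t - f(x) ≤ 0, f(x) - t ≤ 0`, which describes the graph of `f` over `D` inside a box. -/
def graphSystem {n k r : ℕ} (g : Fin r → EuclideanSpace ℝ (Fin n) → ℝ)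
    (f : Fin k → EuclideanSpace ℝ (Fin n) → ℝ) (z : EuclideanSpace ℝ (Fin n ⊕ Fin k)) :
    EuclideanSpace ℝ (Fin r ⊕ Fin k ⊕ Fin k) :=
  WithLp.toLp 2 (Sum.elim (fun l => g l (xPart z))
    (Sum.elim (fun j => tPart z j - f j (xPart z)) (fun j => f j (xPart z) - tPart z j)))

/-- The box `[xL, xU] × [tL, tU]`. -/
def jointBox {n k : ℕ} (xL xU : Fin n → ℝ) (tL tU : Fin k → ℝ) : AABox (Fin n ⊕ Fin k) where
  lo := Sum.elim xL tL
  hi := Sum.elim xU tU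

/-- The graph `{(x, μ) | x ∈ D, μ_i = M_i(f_1(x), …, f_k(x)) for all i}` of the vector of
multilinear compositions. -/
def compositionGraph {n k m : ℕ} (D : Set (EuclideanSpace ℝ (Fin n)))
    (f : Fin k → EuclideanSpace ℝ (Fin n) → ℝ) (M : Fin m → (Fin k → ℝ) → ℝ) :
    Set (EuclideanSpace ℝ (Fin n ⊕ Fin m)) :=
  {w | xPart w ∈ D ∧ ∀ i, tPart w i = M i fun j => f j (xPart w)}

/-- The point set `{(x, μ) | (x, t) is a corner point of H, μ_i = M_i(t) for all i}`. -/
def liftedCorners {n k m q : ℕ} (blk : Fin n ⊕ Fin k → Fin q) (M : Fin m → (Fin k → ℝ) → ℝ)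
    (H : Set (EuclideanSpace ℝ (Fin n ⊕ Fin k))) : Set (EuclideanSpace ℝ (Fin n ⊕ Fin m)) :=
  {w | ∃ z ∈ cornerPoints blk H, xPart w = xPart z ∧ ∀ i, tPart w i = M i (tPart z)}

/-! ### The Lipschitz enclosure is a range procedure -/

theorem AABox.isBounded_toSet {ι : Type} [Fintype ι] (B : AABox ι) :
    Bornology.IsBounded B.toSet := by
  rw [isBounded_iff_forall_norm_le]
  refine ⟨√(∑ i, (max |B.lo i| |B.hi i|) ^ 2), fun x hx => ?_⟩
  rw [EuclideanSpace.norm_eq]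
  apply Real.sqrt_le_sqrt
  apply Finset.sum_le_sum
  intro i _
  have := abs_le_max_abs_abs (hx i).1 (hx i).2
  rw [Real.norm_eq_abs]
  gcongr

theorem isRangeProcedure_lipschitzRange {ι κ : Type} [Fintype ι] [Fintype κ]
    (G : EuclideanSpace ℝ ι → EuclideanSpace ℝ κ) (B₀ : AABox ι) (K : ℝ≥0)
    (hG : ∀ j, LipschitzOnWith K (fun x => G x j) B₀.toSet)
    (c : AABox ι → EuclideanSpace ℝ ι) (hc : ∀ B : AABox ι, B.toSet.Nonempty → c B ∈ B.toSet) :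
    IsRangeProcedure G B₀ (lipschitzRange G K c) := by
  have hbd : ∀ B : AABox ι, B.toSet.Nonempty → ∀ x ∈ B.toSet, ‖x - c B‖ ≤ B.diam := by
    intro B hB x hx
    rw [← dist_eq_norm]
    exact Metric.dist_le_diam_of_mem B.isBounded_toSet hx (hc B hB)
  refine ⟨fun B hB hsub x hx j => ?_, fun δ hδ => ?_⟩
  · have h1 : |G x j - G (c B) j| ≤ K * ‖x - c B‖ := by
      have := (hG j).dist_le_mul x (hsub hx) (c B) (hsub (hc B hB))
      rwa [Real.dist_eq, dist_eq_norm] at this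
    have h2 : ‖x - c B‖ ≤ sSup ((fun x => ‖x - c B‖) '' B.toSet) := by
      apply le_csSup _ (mem_image_of_mem _ hx)
      refine ⟨B.diam, ?_⟩
      rintro _ ⟨y, hy, rfl⟩
      exact hbd B hB y hy
    have h3 := h1.trans (mul_le_mul_of_nonneg_left h2 K.2)
    rw [abs_le] at h3
    simp only [lipschitzRange]
    change _ ≤ _ ∧ _ ≤ _
    constructor
    · change _ - (K : ℝ) * _ ≤ _
      linarith [h3.1]
    · change _ ≤ _ + (K : ℝ) * _
      linarith [h3.2]
  · set A : ℝ := 2 * K * √(Fintype.card κ) + 1 with hA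
    have hApos : 0 < A := by positivity
    refine ⟨δ / (2 * A), by positivity, fun B hB _ hd => ?_⟩
    have hd0 : 0 ≤ B.diam := Metric.diam_nonneg
    set s := sSup ((fun x => ‖x - c B‖) '' B.toSet) with hs
    have hs0 : 0 ≤ s := by
      apply Real.sSup_nonneg
      rintro _ ⟨y, _, rfl⟩
      positivity
    have hs1 : s ≤ B.diam := by
      apply csSup_le (hB.image _)
      rintro _ ⟨y, hy, rfl⟩
      exact hbd B hB y hy
    have hkey : (lipschitzRange G K c B).diam ≤ A * B.diam := by
      apply Metric.diam_le_of_forall_dist_le (by positivity)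
      intro x hx y hy
      have hle : dist x y ≤ √(Fintype.card κ) * (2 * K * s) := by
        rw [EuclideanSpace.dist_eq]
        apply Real.sqrt_le_iff.2
        refine ⟨by positivity, ?_⟩
        rw [mul_pow, Real.sq_sqrt (by positivity)]
        have : ∀ i ∈ (Finset.univ : Finset κ), dist (x i) (y i) ^ 2 ≤ (2 * K * s) ^ 2 := by
          intro i _
          have hx' := hx i
          have hy' := hy i
          simp only [lipschitzRange] at hx' hy'
          have : dist (x i) (y i) ≤ 2 * K * s := by
            rw [Real.dist_eq, abs_le]
            constructor <;> linarith [hx'.1, hx'.2, hy'.1, hy'.2]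
          gcongr
        calc _ ≤ ∑ _i : κ, (2 * K * s) ^ 2 := Finset.sum_le_sum this
          _ = _ := by simp
      calc dist x y ≤ √(Fintype.card κ) * (2 * K * s) := hle
        _ ≤ √(Fintype.card κ) * (2 * K * B.diam) := by gcongr
        _ ≤ A * B.diam := by rw [hA]; nlinarith
    calc _ ≤ A * B.diam := hkey
      _ ≤ A * (δ / (2 * A)) := by gcongr
      _ = δ / 2 := by field_simp
      _ < δ := by linarith

theorem lipschitzOnWith_graphSystem {n k r : ℕ} (xL xU : Fin n → ℝ) (tL tU : Fin k → ℝ)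
    (g : Fin r → EuclideanSpace ℝ (Fin n) → ℝ) (f : Fin k → EuclideanSpace ℝ (Fin n) → ℝ)
    (K : ℝ≥0) (hg : ∀ l, LipschitzOnWith K (g l) (AABox.mk xL xU).toSet)
    (hf : ∀ j, LipschitzOnWith K (f j) (AABox.mk xL xU).toSet)
    (i : Fin r ⊕ Fin k ⊕ Fin k) :
    LipschitzOnWith (1 + K) (fun z => graphSystem g f z i) (jointBox xL xU tL tU).toSet := by
  have hx : ∀ z ∈ (jointBox xL xU tL tU).toSet, xPart z ∈ (AABox.mk xL xU).toSet :=
    fun z hz i => hz (Sum.inl i)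
  have hxd : ∀ z w : EuclideanSpace ℝ (Fin n ⊕ Fin k), dist (xPart z) (xPart w) ≤ dist z w := by
    intro z w
    rw [EuclideanSpace.dist_eq, EuclideanSpace.dist_eq, Fintype.sum_sum_type]
    apply Real.sqrt_le_sqrt
    exact le_add_of_nonneg_right (Finset.sum_nonneg fun _ _ => sq_nonneg _)
  have htd : ∀ (z w : EuclideanSpace ℝ (Fin n ⊕ Fin k)) (j : Fin k),
      |tPart z j - tPart w j| ≤ dist z w := by
    intro z w j
    rw [dist_eq_norm]
    exact PiLp.norm_apply_le (z - w) (Sum.inr j)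
  have hcomp : ∀ h : EuclideanSpace ℝ (Fin n) → ℝ, LipschitzOnWith K h (AABox.mk xL xU).toSet →
      ∀ z ∈ (jointBox xL xU tL tU).toSet, ∀ w ∈ (jointBox xL xU tL tU).toSet,
        |h (xPart z) - h (xPart w)| ≤ K * dist z w := by
    intro h hh z hz w hw
    have := hh.dist_le_mul _ (hx z hz) _ (hx w hw)
    rw [Real.dist_eq] at this
    exact this.trans (mul_le_mul_of_nonneg_left (hxd z w) K.2)
  apply LipschitzOnWith.of_dist_le_mul
  intro z hz w hw
  have hd : 0 ≤ dist z w := dist_nonneg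
  push_cast
  rw [Real.dist_eq]
  rcases i with l | j | j
  · have := hcomp _ (hg l) z hz w hw
    change |g l (xPart z) - g l (xPart w)| ≤ _
    linarith
  · have h1 := abs_le.1 (hcomp _ (hf j) z hz w hw)
    have h2 := abs_le.1 (htd z w j)
    change |tPart z j - f j (xPart z) - (tPart w j - f j (xPart w))| ≤ _
    rw [abs_le]
    constructor <;> linarith [h1.1, h1.2, h2.1, h2.2]
  · have h1 := abs_le.1 (hcomp _ (hf j) z hz w hw)
    have h2 := abs_le.1 (htd z w j)
    change |f j (xPart z) - tPart z j - (f j (xPart w) - tPart w j)| ≤ _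
    rw [abs_le]
    constructor <;> linarith [h1.1, h1.2, h2.1, h2.2]

end

/-!
Write `Φ(x, t) = (x, M(t))`. Both sets of the theorem are images under `Φ`: the graph of the
composition is `Φ(graph f)`, and the lifted corners are `Φ(corner H)`.

*Relaxation.* Since no block contains two of the `t_j`, the map `Φ` is affine in every block. Hence
so is `ℓ ∘ Φ` for a linear functional `ℓ`, and such a function attains its maximum over the compact
set `H` at a corner point (`exists_mem_cornerPoints_ge`): among its maximizers take one of largest
norm; if it were not extreme in some slice, it would be a proper convex combination of points that
are maximizers too and have no larger norm, which strict convexity of the ball forbids. By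
separation, `Φ(H) ⊆ conv Φ(corner H)` (`multilinearLift_mem_convexHull`).

*Polyhedrality.* A corner point of a union of boxes is a vertex of any box that contains it, as
otherwise it could be moved both ways along a coordinate. So there are finitely many corner points,
and the convex hull of finitely many points is a polyhedron by Fourier–Motzkin elimination
(`isPolyhedron_convexHull`).

*Algorithm.* Bisection halves diameters, which bounds the depth of the subdivision and gives
termination. A loop invariant shows that `H` is a union of boxes containing every solution of the
system, and that on each collected box the system is violated by at most the diameter of the
computed range.

*Convergence.* By compactness, the system is violated by a fixed amount at all points of the initial
box whose image under `Φ` is not within `ρ` of `Φ(graph f)`. For small tolerances `H` avoids these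
points, so that `conv Φ(corner H)` lies in the `ρ`-neighbourhood of `conv Φ(graph f)`, and it
contains the latter set by the first part.
-/

/-! ### Convex hulls of finite sets are polyhedra -/

/-- Fourier–Motzkin elimination of one nonnegative variable `c` from a finite homogeneous system
`φ (x - c • v) ≤ 0`. -/
theorem exists_finite_system_add_ray {E : Type*} [AddCommGroup E] [Module ℝ E]
    {F : Set (Module.Dual ℝ E)} (hF : F.Finite) (v : E) :
    ∃ F' : Set (Module.Dual ℝ E), F'.Finite ∧
      ∀ x, (∃ c : ℝ, 0 ≤ c ∧ ∀ φ ∈ F, φ (x - c • v) ≤ 0) ↔ ∀ φ ∈ F', φ x ≤ 0 := by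
  refine ⟨{φ ∈ F | φ v ≤ 0} ∪
    Set.image2 (fun φ ψ => φ v • ψ - ψ v • φ) {φ ∈ F | 0 < φ v} {ψ ∈ F | ψ v < 0},
    (hF.sep _).union ((hF.sep _).image2 _ (hF.sep _)), fun x => ⟨?_, fun h => ?_⟩⟩
  · rintro ⟨c, hc, h⟩ φ (⟨hφ, hv⟩ | ⟨φ, ⟨hφ, hφv⟩, ψ, ⟨hψ, hψv⟩, rfl⟩)
    · have := h φ hφ
      simp only [map_sub, map_smul, smul_eq_mul] at this
      nlinarith
    · have h1 := h φ hφ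
      have h2 := h ψ hψ
      simp only [map_sub, map_smul, smul_eq_mul] at h1 h2
      simp only [LinearMap.sub_apply, LinearMap.smul_apply, smul_eq_mul]
      nlinarith
  -- The smallest admissible `c` is the largest of the lower bounds that the system imposes on it.
  · obtain ⟨c, hcL, hc⟩ := Set.exists_max_image
      (insert (0 : ℝ) ((fun φ : Module.Dual ℝ E => φ x / φ v) '' {φ ∈ F | 0 < φ v})) id
      (((hF.sep _).image _).insert 0) (insert_nonempty _ _)
    refine ⟨c, hc 0 (mem_insert _ _), fun φ hφ => ?_⟩
    simp only [map_sub, map_smul, smul_eq_mul]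
    rcases lt_trichotomy (φ v) 0 with hv | hv | hv
    · have h0 := h φ (Or.inl ⟨hφ, hv.le⟩)
      rcases hcL with rfl | ⟨ψ, ⟨hψ, hψv⟩, rfl⟩
      · simpa using h0
      · have h1 := h _ (Or.inr ⟨ψ, ⟨hψ, hψv⟩, φ, ⟨hφ, hv⟩, rfl⟩)
        simp only [LinearMap.sub_apply, LinearMap.smul_apply, smul_eq_mul] at h1
        have : φ x - ψ x / ψ v * φ v = (ψ v * φ x - φ v * ψ x) / ψ v := by
          field_simp
        rw [this]
        exact div_nonpos_of_nonpos_of_nonneg h1 hψv.le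
    · simpa [hv] using h φ (Or.inl ⟨hφ, hv.le⟩)
    · have := hc _ (Or.inr ⟨φ, ⟨hφ, hv⟩, rfl⟩)
      simp only [id, div_le_iff₀ hv] at this
      linarith

/-- **Weyl's theorem**: a finitely generated cone in a finite-dimensional space is the solution set
of a finite homogeneous system of linear inequalities. -/
theorem exists_finite_system_cone {E α : Type*} [AddCommGroup E] [Module ℝ E]
    [FiniteDimensional ℝ E] (v : α → E) (s : Finset α) :
    ∃ F : Set (Module.Dual ℝ E), F.Finite ∧
      ∀ x, (∃ w : α → ℝ, (∀ i ∈ s, 0 ≤ w i) ∧ ∑ i ∈ s, w i • v i = x) ↔ ∀ φ ∈ F, φ x ≤ 0 := by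
  classical
  induction s using Finset.induction_on with
  | empty =>
    let e := Module.finBasis ℝ E
    refine ⟨range e.coord ∪ range fun i => -e.coord i,
      (finite_range _).union (finite_range _), fun x => ⟨?_, fun h => ⟨0, by simp, ?_⟩⟩⟩
    · rintro ⟨w, -, rfl⟩ φ -
      simp
    · rw [Finset.sum_empty, eq_comm, ← e.forall_coord_eq_zero_iff]
      intro i
      have h1 := h _ (Or.inl ⟨i, rfl⟩)
      have h2 := h _ (Or.inr ⟨i, rfl⟩)
      rw [LinearMap.neg_apply] at h2
      linarith
  | insert a s ha ih =>
    obtain ⟨F, hF, h⟩ := ih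
    obtain ⟨F', hF', h'⟩ := exists_finite_system_add_ray hF (v a)
    refine ⟨F', hF', fun x => ?_⟩
    rw [← h']
    simp_rw [← h]
    constructor
    · rintro ⟨w, hw, rfl⟩
      refine ⟨w a, hw a (Finset.mem_insert_self _ _), w,
        fun i hi => hw i (Finset.mem_insert_of_mem hi), ?_⟩
      rw [Finset.sum_insert ha, add_sub_cancel_left]
    · rintro ⟨c, hc, w, hw, hx⟩
      have hne : ∀ i ∈ s, i ≠ a := fun i hi hia => ha (hia ▸ hi)
      refine ⟨Function.update w a c, fun i hi => ?_, ?_⟩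
      · rcases Finset.mem_insert.1 hi with rfl | hi
        · simpa using hc
        · simpa [hne i hi] using hw i hi
      · rw [Finset.sum_insert ha, Function.update_self,
          Finset.sum_congr rfl fun i hi => by rw [Function.update_of_ne (hne i hi)], hx]
        abel

/-- A polytope is a polyhedron: it is the slice at height `1` of the cone over its vertices. -/
theorem isPolyhedron_convexHull {ι : Type} [Fintype ι] {V : Set (EuclideanSpace ℝ ι)}
    (hV : V.Finite) : IsPolyhedron (convexHull ℝ V) := by
  classical
  obtain ⟨F, hF, h⟩ := exists_finite_system_cone
    (fun y : EuclideanSpace ℝ ι => (y, (1 : ℝ))) hV.toFinset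
  have hmem : ∀ x, x ∈ convexHull ℝ V ↔ ∀ φ ∈ F, φ (x, (1 : ℝ)) ≤ 0 := by
    intro x
    rw [← h, show convexHull ℝ V = convexHull ℝ ↑hV.toFinset by rw [hV.coe_toFinset],
      Finset.mem_convexHull]
    refine exists_congr fun w => and_congr_right fun _ => ?_
    simp only [Prod.ext_iff, Prod.smul_mk, Prod.fst_sum, Prod.snd_sum, smul_eq_mul, mul_one]
    constructor
    · rintro ⟨h1, rfl⟩
      exact ⟨by simp [Finset.centerMass_eq_of_sum_1 _ _ h1], h1⟩
    · rintro ⟨rfl, h1⟩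
      exact ⟨h1, by simp [Finset.centerMass_eq_of_sum_1 _ _ h1]⟩
  have := hF.to_subtype
  obtain ⟨N, ⟨e⟩⟩ := Finite.exists_equiv_fin F
  refine ⟨N, fun l i => (e.symm l).1 (EuclideanSpace.single i 1, 0), fun l => -(e.symm l).1 (0, 1),
    ?_⟩
  ext x
  have key : ∀ φ : Module.Dual ℝ (EuclideanSpace ℝ ι × ℝ),
      φ (x, 1) = ∑ i, φ (EuclideanSpace.single i 1, 0) * x i + φ (0, 1) := by
    intro φ
    have hx : x = ∑ i, x i • EuclideanSpace.single i (1 : ℝ) := by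
      simpa using ((EuclideanSpace.basisFun ι ℝ).sum_repr x).symm
    have : (x, (1 : ℝ)) = ∑ i, x i • (EuclideanSpace.single i (1 : ℝ), (0 : ℝ)) + (0, 1) := by
      ext1
      · simpa [Prod.fst_sum] using hx
      · simp [Prod.snd_sum]
    rw [this, map_add, map_sum]
    refine congrArg (· + φ (0, 1)) (Finset.sum_congr rfl fun i _ => ?_)
    rw [map_smul, smul_eq_mul, mul_comm]
  rw [hmem, mem_ofPred_eq]
  constructor
  · intro hx l
    have := hx _ (e.symm l).2
    rw [key] at this
    linarith
  · intro hx φ hφ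
    have := hx (e ⟨φ, hφ⟩)
    simp only [Equiv.symm_apply_apply] at this
    rw [key]
    linarith

/-! ### Boxes -/

namespace AABox

variable {ι : Type}

theorem toSet_eq_preimage (B : AABox ι) :
    B.toSet = WithLp.ofLp ⁻¹' (univ.pi fun i => Icc (B.lo i) (B.hi i)) := by
  ext x
  simp only [toSet, mem_ofPred_eq, mem_preimage, mem_univ_pi, mem_Icc]

theorem isClosed_toSet (B : AABox ι) : IsClosed B.toSet := by
  rw [toSet_eq_preimage]
  exact (isClosed_set_pi fun _ _ => isClosed_Icc).preimage (PiLp.continuous_ofLp 2 _)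

theorem isCompact_toSet [Fintype ι] (B : AABox ι) : IsCompact B.toSet :=
  Metric.isCompact_of_isClosed_isBounded B.isClosed_toSet B.isBounded_toSet

/-- The finitely many points of a box with every coordinate at one of its two bounds. -/
def vertices (B : AABox ι) : Set (EuclideanSpace ℝ ι) :=
  {x | ∀ i, x i = B.lo i ∨ x i = B.hi i}

theorem vertices_eq_preimage (B : AABox ι) :
    B.vertices = WithLp.ofLp ⁻¹' (univ.pi fun i => {B.lo i, B.hi i}) := by
  ext x
  simp [vertices]

theorem finite_vertices [Finite ι] (B : AABox ι) : B.vertices.Finite := by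
  rw [vertices_eq_preimage]
  exact (Finite.pi fun _ => toFinite _).preimage (WithLp.ofLp_injective 2).injOn

theorem isPolytope_toSet [Finite ι] (B : AABox ι) : IsPolytope B.toSet := by
  by_cases h : ∀ i, B.lo i ≤ B.hi i
  · refine ⟨B.vertices, B.finite_vertices, ?_⟩
    have h1 : WithLp.ofLp '' B.vertices = univ.pi fun i => {B.lo i, B.hi i} := by
      rw [vertices_eq_preimage, image_preimage_eq _ (WithLp.ofLp_surjective 2)]
    have h2 := LinearMap.image_convexHull
      (WithLp.linearEquiv 2 ℝ (ι → ℝ)).toLinearMap B.vertices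
    have h3 : ((WithLp.linearEquiv 2 ℝ (ι → ℝ)).toLinearMap : _ → ι → ℝ) = WithLp.ofLp := rfl
    rw [h3, h1, convexHull_pi] at h2
    rw [toSet_eq_preimage, ← preimage_image_eq (convexHull ℝ B.vertices)
      (WithLp.ofLp_injective 2), h2]
    simp [segment_eq_Icc, h]
  · push Not at h
    obtain ⟨i, hi⟩ := h
    refine ⟨∅, finite_empty, ?_⟩
    rw [convexHull_empty, eq_empty_iff_forall_notMem]
    intro x hx
    exact absurd ((hx i).1.trans (hx i).2) hi.not_ge

theorem child_subset (B : AABox ι) (s : ι → Bool) : (B.child s).toSet ⊆ B.toSet := by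
  intro x hx i
  have := hx i
  simp only [child] at this
  split_ifs at this <;> constructor <;> linarith [this.1, this.2]

theorem exists_mem_child (B : AABox ι) {x : EuclideanSpace ℝ ι} (hx : x ∈ B.toSet) :
    ∃ s, x ∈ (B.child s).toSet := by
  refine ⟨fun i => decide ((B.lo i + B.hi i) / 2 ≤ x i), fun i => ?_⟩
  have := hx i
  by_cases h : (B.lo i + B.hi i) / 2 ≤ x i
  · simpa [child, h] using this.2
  · simpa [child, h] using ⟨this.1, (not_le.1 h).le⟩

/-- A child is mapped into its parent by the homothety of ratio `2` centred at the vertex that they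
share. -/
theorem diam_child_le [Fintype ι] (B : AABox ι) (s : ι → Bool) :
    (B.child s).diam ≤ B.diam / 2 := by
  have hB : 0 ≤ B.diam := Metric.diam_nonneg
  apply Metric.diam_le_of_forall_dist_le (by positivity)
  let c : EuclideanSpace ℝ ι := WithLp.toLp 2 fun i => if s i then B.hi i else B.lo i
  have hc : ∀ x ∈ (B.child s).toSet, (2 : ℝ) • x - c ∈ B.toSet := by
    intro x hx i
    have := hx i
    simp only [child] at this
    simp only [PiLp.sub_apply, PiLp.smul_apply, smul_eq_mul, c]
    split_ifs at this ⊢ <;> constructor <;> linarith [this.1, this.2]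
  intro x hx y hy
  have := Metric.dist_le_diam_of_mem B.isBounded_toSet (hc x hx) (hc y hy)
  rw [dist_sub_right, dist_smul₀, Real.norm_two] at this
  change _ ≤ Metric.diam B.toSet / 2
  linarith

theorem hi_sub_lo_le_diam [Fintype ι] (B : AABox ι) (hB : B.toSet.Nonempty) (i : ι) :
    B.hi i - B.lo i ≤ B.diam := by
  obtain ⟨x, hx⟩ := hB
  have hle : ∀ i, B.lo i ≤ B.hi i := fun i => (hx i).1.trans (hx i).2
  have h1 : WithLp.toLp 2 B.hi ∈ B.toSet := fun i => ⟨hle i, le_rfl⟩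
  have h2 : WithLp.toLp 2 B.lo ∈ B.toSet := fun i => ⟨le_rfl, hle i⟩
  have h3 := Metric.dist_le_diam_of_mem B.isBounded_toSet h1 h2
  rw [dist_eq_norm] at h3
  exact (le_abs_self _).trans
    ((PiLp.norm_apply_le (WithLp.toLp 2 B.hi - WithLp.toLp 2 B.lo) i).trans h3)

end AABox

theorem isAxisAligned_biUnion_toSet {ι : Type} [Finite ι] {q : ℕ} (blk : ι → Fin q)
    (R : List (AABox ι)) : IsAxisAligned blk (⋃ B ∈ R, B.toSet) := by
  refine ⟨R.length,
    fun a b => (AABox.mk (fun i => (R.get a).lo i.1) (fun i => (R.get a).hi i.1)).toSet,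
    fun a b => AABox.isPolytope_toSet _, ?_⟩
  have h : ∀ B : AABox ι, B.toSet = {x | ∀ b,
      blockPart blk b x ∈ (AABox.mk (fun i => B.lo i.1) (fun i => B.hi i.1)).toSet} := by
    intro B
    ext x
    exact ⟨fun hx b i => hx i.1, fun hx i => hx (blk i) ⟨i, rfl⟩⟩
  simp_rw [← h]
  ext x
  simp only [mem_iUnion, exists_prop]
  constructor
  · rintro ⟨B, hB, hx⟩
    obtain ⟨a, rfl⟩ := List.get_of_mem hB
    exact ⟨a, hx⟩
  · rintro ⟨a, hx⟩
    exact ⟨_, List.get_mem R a, hx⟩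

/-! ### Corner points -/

/-- A continuous function that is affine in every block attains its maximum over a compact set `H`
at a corner point. Among the maximizers over `H`, one of largest norm will do. -/
theorem exists_mem_cornerPoints_ge {ι : Type} [Fintype ι] {q : ℕ} (blk : ι → Fin q)
    {H : Set (EuclideanSpace ℝ ι)} (hH : IsCompact H) {h : EuclideanSpace ℝ ι → ℝ}
    (hc : Continuous h)
    (haff : ∀ (b : Fin q) (y z : EuclideanSpace ℝ ι), (∀ i, blk i ≠ b → y i = z i) →
      ∀ s t : ℝ, s + t = 1 → h (s • y + t • z) = s * h y + t * h z)
    {z : EuclideanSpace ℝ ι} (hz : z ∈ H) : ∃ v ∈ cornerPoints blk H, h z ≤ h v := by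
  obtain ⟨u, huH, hu⟩ := hH.exists_isMaxOn ⟨z, hz⟩ hc.continuousOn
  have hK : IsCompact (H ∩ h ⁻¹' {h u}) := hH.inter_right (isClosed_singleton.preimage hc)
  obtain ⟨v, ⟨hvH, hvu⟩, hv⟩ := hK.exists_isMaxOn ⟨u, huH, rfl⟩ continuous_norm.continuousOn
  replace hvu : h v = h u := hvu
  refine ⟨v, ⟨hvH, fun b => ?_⟩, hvu ▸ hu hz⟩
  -- The slice lies in the set `T`, which is convex since `h` is affine along the block `b`.
  let T : Set (EuclideanSpace ℝ ι) :=
    {y | (∀ i, blk i ≠ b → y i = v i) ∧ (h y < h v ∨ h y = h v ∧ ‖y‖ ≤ ‖v‖)}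
  have hT : Convex ℝ T := by
    rintro y ⟨hy, hy'⟩ y' ⟨hy₂, hy₂'⟩ s t hs ht hst
    refine ⟨fun i hi => ?_, ?_⟩
    · simp only [PiLp.add_apply, PiLp.smul_apply, smul_eq_mul, hy i hi, hy₂ i hi]
      rw [← add_mul, hst, one_mul]
    · rw [haff b y y' (fun i hi => (hy i hi).trans (hy₂ i hi).symm) s t hst]
      rcases hs.eq_or_lt with rfl | hs
      · obtain rfl : t = 1 := by linarith
        simpa using hy₂'
      rcases ht.eq_or_lt with rfl | ht
      · obtain rfl : s = 1 := by linarith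
        simpa using hy'
      have hv1 : h v = s * h v + t * h v := by rw [← add_mul, hst, one_mul]
      rcases hy' with hy' | ⟨hy', hn⟩
      · left
        have : h y' ≤ h v := hy₂'.elim le_of_lt fun h => h.1.le
        nlinarith
      rcases hy₂' with hy₂' | ⟨hy₂', hn₂⟩
      · left
        nlinarith
      · right
        refine ⟨by rw [hy', hy₂', ← hv1], (norm_add_le _ _).trans ?_⟩
        rw [norm_smul, norm_smul, Real.norm_of_nonneg hs.le, Real.norm_of_nonneg ht.le]
        have : ‖v‖ = s * ‖v‖ + t * ‖v‖ := by rw [← add_mul, hst, one_mul]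
        nlinarith
  have hsub : convexHull ℝ {x | x ∈ H ∧ ∀ i, blk i ≠ b → x i = v i} ⊆ T := by
    refine convexHull_min (fun x hx => ⟨hx.2, ?_⟩) hT
    have h1 : h x ≤ h u := hu hx.1
    rw [hvu]
    refine h1.lt_or_eq.imp_right fun h2 => ⟨h2, hv (show x ∈ H ∩ h ⁻¹' {h u} from ⟨hx.1, h2⟩)⟩
  refine mem_extremePoints_iff_left.2 ⟨subset_convexHull ℝ _ ⟨hvH, fun _ _ => rfl⟩, ?_⟩
  rintro y hy y' hy' ⟨s, t, hs, ht, hst, hsv⟩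
  obtain ⟨hyb, hyT⟩ := hsub hy
  obtain ⟨hyb', hyT'⟩ := hsub hy'
  have hval := haff b y y' (fun i hi => (hyb i hi).trans (hyb' i hi).symm) s t hst
  rw [hsv] at hval
  have hv1 : h v = s * h v + t * h v := by rw [← add_mul, hst, one_mul]
  have hle : h y ≤ h v := hyT.elim le_of_lt fun h => h.1.le
  have hle' : h y' ≤ h v := hyT'.elim le_of_lt fun h => h.1.le
  have hn : ‖y‖ ≤ ‖v‖ := by
    rcases hyT with hlt | h
    · nlinarith
    · exact h.2
  have hn' : ‖y'‖ ≤ ‖v‖ := by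
    rcases hyT' with hlt | h
    · nlinarith
    · exact h.2
  by_contra hne
  -- Balls are strictly convex, so `v` would have smaller norm than itself.
  have hyy' : y ≠ y' := by
    rintro rfl
    apply hne
    rw [← hsv, ← add_smul, hst, one_smul]
  have := norm_combo_lt_of_ne hn hn' hyy' hs ht hst
  rw [hsv] at this
  exact this.false

/-- A corner point of a union of boxes is a vertex of each of the boxes that contain it: otherwise
it could be moved in both directions along some coordinate. -/
theorem cornerPoints_inter_toSet_subset {ι : Type} {q : ℕ} (blk : ι → Fin q)
    {H : Set (EuclideanSpace ℝ ι)} {B : AABox ι} (hB : B.toSet ⊆ H) :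
    cornerPoints blk H ∩ B.toSet ⊆ B.vertices := by
  classical
  rintro v ⟨⟨hvH, hv⟩, hvB⟩ i
  by_contra! hne
  have h1 : B.lo i < v i := lt_of_le_of_ne (hvB i).1 hne.1.symm
  have h2 : v i < B.hi i := lt_of_le_of_ne (hvB i).2 hne.2
  let e : ℝ := min (v i - B.lo i) (B.hi i - v i)
  have he : 0 < e := lt_min (by linarith) (by linarith)
  have he1 : e ≤ v i - B.lo i := min_le_left _ _
  have he2 : e ≤ B.hi i - v i := min_le_right _ _
  let w : ℝ → EuclideanSpace ℝ ι := fun d => WithLp.toLp 2 (Function.update v.ofLp i (v i + d))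
  have hwi : ∀ d, w d i = v i + d := fun d => by simp [w]
  have hwj : ∀ d j, j ≠ i → w d j = v j := fun d j hj => by simp [w, hj]
  have hw : ∀ d, |d| ≤ e →
      w d ∈ convexHull ℝ {x | x ∈ H ∧ ∀ j, blk j ≠ blk i → x j = v j} := by
    intro d hd
    rw [abs_le] at hd
    refine subset_convexHull ℝ _ ⟨hB fun j => ?_, fun j hj => hwj d j fun h => hj (h ▸ rfl)⟩
    rcases eq_or_ne j i with rfl | hj
    · rw [hwi]
      constructor <;> linarith
    · rw [hwj d j hj]
      exact hvB j
  have hmid : v ∈ openSegment ℝ (w e) (w (-e)) := by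
    refine ⟨1 / 2, 1 / 2, by norm_num, by norm_num, by norm_num, ?_⟩
    ext j
    simp only [PiLp.add_apply, PiLp.smul_apply, smul_eq_mul]
    rcases eq_or_ne j i with rfl | hj
    · rw [hwi, hwi]
      ring
    · rw [hwj _ j hj, hwj _ j hj]
      ring
  have heq := (mem_extremePoints_iff_left.1 (hv (blk i))).2 _ (hw e (abs_of_pos he).le) _
    (hw (-e) (by rw [abs_neg, abs_of_pos he])) hmid
  have := hwi e
  rw [heq] at this
  linarith

theorem finite_cornerPoints_biUnion_toSet {ι : Type} [Finite ι] {q : ℕ} (blk : ι → Fin q)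
    (R : List (AABox ι)) : (cornerPoints blk (⋃ B ∈ R, B.toSet)).Finite := by
  classical
  refine (R.toFinset.finite_toSet.biUnion fun B _ => B.finite_vertices).subset fun v hv => ?_
  obtain ⟨B, hB, hvB⟩ := mem_iUnion₂.1 hv.1
  exact mem_iUnion₂.2 ⟨B, by simpa using hB,
    cornerPoints_inter_toSet_subset blk (subset_iUnion₂_of_subset B hB subset_rfl) ⟨hv, hvB⟩⟩

/-! ### Multilinear functions -/

theorem IsMultilinear.apply_update {k : ℕ} {M : (Fin k → ℝ) → ℝ} (hM : IsMultilinear M)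
    (u : Fin k → ℝ) (j : Fin k) (s : ℝ) :
    M (Function.update u j s) = M (Function.update u j 0) +
      s * (M (Function.update u j 1) - M (Function.update u j 0)) := by
  obtain ⟨a, b, h⟩ := hM u j
  rw [h, h, h]
  ring

theorem IsMultilinear.continuous {k : ℕ} {M : (Fin k → ℝ) → ℝ} (hM : IsMultilinear M) :
    Continuous M := by
  -- Free the variables one at a time.
  have key : ∀ (s : Finset (Fin k)) (u : Fin k → ℝ), Continuous fun t => M (s.piecewise t u) := by
    intro s
    induction s using Finset.induction_on with
    | empty => exact fun u => by simpa using continuous_const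
    | insert j s hj ih =>
      intro u
      have h : ∀ (t : Fin k → ℝ) (c : ℝ),
          Function.update (s.piecewise t u) j c = s.piecewise t (Function.update u j c) :=
        fun t c => Finset.update_piecewise_of_notMem s t u hj c
      have hfun : (fun t => M ((insert j s).piecewise t u)) =
          fun t => M (s.piecewise t (Function.update u j 0)) +
            t j * (M (s.piecewise t (Function.update u j 1)) -
              M (s.piecewise t (Function.update u j 0))) := by
        funext t
        rw [Finset.piecewise_insert, hM.apply_update, h, h]
      rw [hfun]
      exact (ih _).add ((continuous_apply j).mul ((ih _).sub (ih _)))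
  simpa using key Finset.univ 0

theorem IsMultilinear.map_combo {k : ℕ} {M : (Fin k → ℝ) → ℝ} (hM : IsMultilinear M)
    {y z : Fin k → ℝ} {j : Fin k} (h : ∀ i, i ≠ j → y i = z i) {s t : ℝ} (hst : s + t = 1) :
    M (s • y + t • z) = s * M y + t * M z := by
  obtain ⟨a, b, hab⟩ := hM y j
  have hy : y = Function.update y j (y j) := by simp
  have hz : z = Function.update y j (z j) := by
    ext i
    rcases eq_or_ne i j with rfl | hi
    · simp
    · simp [hi, h i hi]
  have hyz : s • y + t • z = Function.update y j (s * y j + t * z j) := by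
    ext i
    rcases eq_or_ne i j with rfl | hi
    · simp
    · simp [hi, ← h i hi, ← add_mul, hst]
  rw [hyz, hab, show M y = a * y j + b from hy ▸ hab (y j) ▸ by simp,
    show M z = a * z j + b by rw [hz, hab]; simp]
  linear_combination (-b) * hst

/-- The map `(x, t) ↦ (x, M(t))`. -/
noncomputable def multilinearLift {n k m : ℕ} (M : Fin m → (Fin k → ℝ) → ℝ)
    (z : EuclideanSpace ℝ (Fin n ⊕ Fin k)) : EuclideanSpace ℝ (Fin n ⊕ Fin m) :=
  WithLp.toLp 2 (Sum.elim (fun i => z (Sum.inl i)) fun i => M i (tPart z))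

theorem eq_multilinearLift_iff {n k m : ℕ} (M : Fin m → (Fin k → ℝ) → ℝ)
    (z : EuclideanSpace ℝ (Fin n ⊕ Fin k)) (w : EuclideanSpace ℝ (Fin n ⊕ Fin m)) :
    multilinearLift M z = w ↔ xPart w = xPart z ∧ ∀ i, tPart w i = M i (tPart z) := by
  constructor
  · rintro rfl
    exact ⟨rfl, fun _ => rfl⟩
  · rintro ⟨hx, ht⟩
    ext (i | i)
    · exact (congrArg (fun u : EuclideanSpace ℝ (Fin n) => u i) hx).symm
    · exact (ht i).symm

theorem liftedCorners_eq_image {n k m q : ℕ} (blk : Fin n ⊕ Fin k → Fin q)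
    (M : Fin m → (Fin k → ℝ) → ℝ) (H : Set (EuclideanSpace ℝ (Fin n ⊕ Fin k))) :
    liftedCorners blk M H = multilinearLift M '' cornerPoints blk H := by
  ext w
  simp only [liftedCorners, mem_ofPred_eq, mem_image, eq_multilinearLift_iff]

theorem compositionGraph_eq_image {n k m : ℕ} (D : Set (EuclideanSpace ℝ (Fin n)))
    (f : Fin k → EuclideanSpace ℝ (Fin n) → ℝ) (M : Fin m → (Fin k → ℝ) → ℝ) :
    compositionGraph D f M = multilinearLift M '' graphOver D f := by
  ext w
  simp only [compositionGraph, graphOver, mem_ofPred_eq, mem_image, eq_multilinearLift_iff]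
  constructor
  · rintro ⟨hD, hw⟩
    exact ⟨WithLp.toLp 2 (Sum.elim (xPart w) fun j => f j (xPart w)), ⟨hD, fun _ => rfl⟩, rfl, hw⟩
  · rintro ⟨z, ⟨hD, hz⟩, hx, hw⟩
    rw [hx]
    refine ⟨hD, fun i => ?_⟩
    rw [hw i, funext hz]

theorem continuous_multilinearLift {n k m : ℕ} {M : Fin m → (Fin k → ℝ) → ℝ}
    (hM : ∀ i, IsMultilinear (M i)) :
    Continuous (multilinearLift M : EuclideanSpace ℝ (Fin n ⊕ Fin k) → _) := by
  refine (PiLp.continuous_toLp 2 _).comp (continuous_pi ?_)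
  rintro (i | i)
  · exact (EuclideanSpace.proj (𝕜 := ℝ) (Sum.inl i)).continuous
  · exact (hM i).continuous.comp
      (continuous_pi fun j => (EuclideanSpace.proj (𝕜 := ℝ) (Sum.inr j)).continuous)

/-- As no block contains two of the coordinates `t_j`, the map `(x, t) ↦ (x, M(t))` is affine in
every block. -/
theorem multilinearLift_combo {n k m q : ℕ} {M : Fin m → (Fin k → ℝ) → ℝ}
    (hM : ∀ i, IsMultilinear (M i)) (blk : Fin n ⊕ Fin k → Fin q)
    (hblk : Function.Injective fun j : Fin k => blk (Sum.inr j)) (b : Fin q)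
    (y z : EuclideanSpace ℝ (Fin n ⊕ Fin k)) (hyz : ∀ i, blk i ≠ b → y i = z i)
    (s t : ℝ) (hst : s + t = 1) :
    multilinearLift M (s • y + t • z) = s • multilinearLift M y + t • multilinearLift M z := by
  ext (i | i)
  · rfl
  · change M i (s • tPart y + t • tPart z) = s * M i (tPart y) + t * M i (tPart z)
    by_cases hb : ∃ j : Fin k, blk (Sum.inr j) = b
    · obtain ⟨j, rfl⟩ := hb
      exact (hM i).map_combo (fun j' hj' => hyz _ fun h => hj' (hblk h)) hst
    · push Not at hb
      have : tPart y = tPart z := funext fun j => hyz _ (hb j)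
      rw [this, ← add_smul, ← add_mul, hst, one_smul, one_mul]

/-- If a point of the image were not in the convex hull, a linear functional would separate it from
the images of the corner points, but composed with the lift it attains its maximum at one. -/
theorem multilinearLift_mem_convexHull {n k m q : ℕ} {M : Fin m → (Fin k → ℝ) → ℝ}
    (hM : ∀ i, IsMultilinear (M i)) (blk : Fin n ⊕ Fin k → Fin q)
    (hblk : Function.Injective fun j : Fin k => blk (Sum.inr j))
    {H : Set (EuclideanSpace ℝ (Fin n ⊕ Fin k))} (hH : IsCompact H)
    (hfin : (liftedCorners blk M H).Finite) {z : EuclideanSpace ℝ (Fin n ⊕ Fin k)} (hz : z ∈ H) :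
    multilinearLift M z ∈ convexHull ℝ (liftedCorners blk M H) := by
  by_contra hnot
  obtain ⟨φ, u, hφ, hu⟩ := geometric_hahn_banach_closed_point (convex_convexHull ℝ _)
    (hfin.isClosed_convexHull ℝ) hnot
  obtain ⟨v, hv, hle⟩ := exists_mem_cornerPoints_ge blk hH
    (φ.continuous.comp (continuous_multilinearLift hM))
    (fun b y y' hyy' s t hst => by
      simp [multilinearLift_combo hM blk hblk b y y' hyy' s t hst]) hz
  have := hφ _ (subset_convexHull ℝ _
    (liftedCorners_eq_image blk M H ▸ mem_image_of_mem (multilinearLift M) hv))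
  exact (this.trans hu).not_ge hle

/-! ### The subdivision algorithm -/

section Subdivision

variable {ι κ : Type} [Fintype ι] [DecidableEq ι]

theorem AABox.mem_split {B C : AABox ι} : C ∈ B.split ↔ ∃ s, B.child s = C := by
  simp [AABox.split]

/-- Bisection halves the diameter, so that a box of diameter less than `2 ^ d * ε` is processed
after at most `d` levels of subdivision. -/
theorem exists_iterate_subdivisionStep (range : AABox ι → AABox κ) {ε : ℝ} (d : ℕ) :
    ∀ L : List (AABox ι), (∀ B ∈ L, B.diam < 2 ^ d * ε) → ∀ U R : List (AABox ι),
      ∃ (N : ℕ) (R' : List (AABox ι)), (subdivisionStep range ε)^[N] (L ++ U, R) = (U, R') := by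
  induction d with
  | zero =>
    intro L
    induction L with
    | nil => exact fun _ U R => ⟨0, R, rfl⟩
    | cons B L ih =>
      intro hL U R
      have hB : ¬ε ≤ B.diam := by simpa using hL B (by simp)
      obtain ⟨R₁, h1⟩ : ∃ R₁, subdivisionStep range ε (B :: (L ++ U), R) = (L ++ U, R₁) := by
        simp only [subdivisionStep, hB, if_false]
        split_ifs <;> exact ⟨_, rfl⟩
      obtain ⟨N, R', h2⟩ := ih (fun C hC => hL C (by simp [hC])) U R₁
      exact ⟨N + 1, R', by rw [Function.iterate_succ_apply, List.cons_append, h1, h2]⟩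
  | succ d ihd =>
    intro L
    induction L with
    | nil => exact fun _ U R => ⟨0, R, rfl⟩
    | cons B L ih =>
      intro hL U R
      have hB : B.diam < 2 ^ (d + 1) * ε := hL B (by simp)
      obtain ⟨N₁, R₁, h1⟩ : ∃ N₁ R₁,
          (subdivisionStep range ε)^[N₁] (B :: (L ++ U), R) = (L ++ U, R₁) := by
        by_cases hs : subdivisionStep range ε (B :: (L ++ U), R) = (B.split ++ (L ++ U), R)
        · obtain ⟨N, R', h⟩ := ihd B.split (fun C hC => by
            obtain ⟨s, rfl⟩ := AABox.mem_split.1 hC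
            have := B.diam_child_le s
            rw [pow_succ] at hB
            linarith) (L ++ U) R
          exact ⟨N + 1, R', by rw [Function.iterate_succ_apply, hs, h]⟩
        · refine ⟨1, ?_⟩
          rw [Function.iterate_one]
          simp only [subdivisionStep] at hs ⊢
          split_ifs at hs ⊢ <;> first | exact ⟨_, rfl⟩ | exact absurd rfl hs
      obtain ⟨N, R', h2⟩ := ih (fun C hC => hL C (by simp [hC])) U R₁
      exact ⟨N + N₁, R', by rw [Function.iterate_add_apply, List.cons_append, h1, h2]⟩

theorem exists_subdivisionReturns (range : AABox ι → AABox κ) {ε : ℝ} (hε : 0 < ε)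
    (B₀ : AABox ι) : ∃ H, SubdivisionReturns range ε B₀ H := by
  obtain ⟨d, hd⟩ := pow_unbounded_of_one_lt (B₀.diam / ε) one_lt_two
  rw [div_lt_iff₀ hε] at hd
  obtain ⟨N, R, h⟩ := exists_iterate_subdivisionStep range d [B₀] (by simpa using hd) [] []
  exact ⟨_, N, R, h, rfl⟩

/-- The invariant of the main loop, for a state `S` given by the stack `S.1` and the collected boxes
`S.2`; `Z` is a set of points that must not be lost. -/
structure SubdivisionInvariant (range : AABox ι → AABox κ) (ε : ℝ) (B₀ : AABox ι)
    (Z : Set (EuclideanSpace ℝ ι)) (S : List (AABox ι) × List (AABox ι)) : Prop where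
  /-- the boxes on the stack are sub-boxes of `B₀` -/
  stack_subset : ∀ B ∈ S.1, B.toSet ⊆ B₀.toSet
  /-- the collected boxes are sub-boxes of `B₀` -/
  collected_subset : ∀ B ∈ S.2, B.toSet ⊆ B₀.toSet
  /-- every collected box has passed one of the two tests for collection -/
  collected : ∀ B ∈ S.2, (∀ j, (range B).hi j ≤ 0) ∨ (∀ j, (range B).lo j ≤ 0) ∧ B.diam < ε
  /-- the boxes cover the set `Z` -/
  cover : ∀ z ∈ Z, ∃ B, (B ∈ S.1 ∨ B ∈ S.2) ∧ z ∈ B.toSet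

theorem SubdivisionInvariant.step {range : AABox ι → AABox κ} {ε : ℝ} {B₀ : AABox ι}
    {Z : Set (EuclideanSpace ℝ ι)}
    (hZ : ∀ B : AABox ι, B.toSet ⊆ B₀.toSet → ∀ z ∈ Z, z ∈ B.toSet → ∀ j, (range B).lo j ≤ 0)
    {S : List (AABox ι) × List (AABox ι)} (hS : SubdivisionInvariant range ε B₀ Z S) :
    SubdivisionInvariant range ε B₀ Z (subdivisionStep range ε S) := by
  obtain ⟨U, R⟩ := S
  cases U with
  | nil => exact hS
  | cons B U =>
    obtain ⟨hU, hR, hR', hcov⟩ := hS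
    simp only [List.mem_cons] at hU hR hR' hcov
    have hB := hU B (Or.inl rfl)
    have hcov' : ∀ z ∈ Z, z ∈ B.toSet ∨ ∃ C, (C ∈ U ∨ C ∈ R) ∧ z ∈ C.toSet := by
      intro z hz
      obtain ⟨C, ((rfl | hC) | hC), hzC⟩ := hcov z hz
      · exact Or.inl hzC
      · exact Or.inr ⟨C, Or.inl hC, hzC⟩
      · exact Or.inr ⟨C, Or.inr hC, hzC⟩
    have hcollect : ((∀ j, (range B).hi j ≤ 0) ∨ (∀ j, (range B).lo j ≤ 0) ∧ B.diam < ε) →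
        SubdivisionInvariant range ε B₀ Z (U, B :: R) := by
      refine fun h => ⟨fun C hC => hU C (Or.inr hC), ?_, ?_, fun z hz => ?_⟩
      · simpa [hB] using hR
      · simpa only [List.mem_cons, forall_eq_or_imp] using And.intro h hR'
      · rcases hcov' z hz with h | ⟨C, hC, hzC⟩
        · exact ⟨B, by simp, h⟩
        · exact ⟨C, by simpa using hC.imp_right Or.inr, hzC⟩
    simp only [subdivisionStep]
    split_ifs with h1 h2 h3
    · exact hcollect (Or.inl h1)
    · obtain ⟨j, hj⟩ := h2
      refine ⟨fun C hC => hU C (Or.inr hC), hR, hR', fun z hz => ?_⟩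
      rcases hcov' z hz with h | h
      · exact absurd (hZ B hB z hz h j) hj.not_ge
      · exact h
    · refine ⟨fun C hC => ?_, hR, hR', fun z hz => ?_⟩
      · rcases List.mem_append.1 hC with hC | hC
        · obtain ⟨s, rfl⟩ := AABox.mem_split.1 hC
          exact (B.child_subset s).trans hB
        · exact hU C (Or.inr hC)
      · rcases hcov' z hz with h | ⟨C, hC, hzC⟩
        · obtain ⟨s, hs⟩ := B.exists_mem_child h
          exact ⟨_, Or.inl (List.mem_append_left _ (AABox.mem_split.2 ⟨s, rfl⟩)), hs⟩
        · exact ⟨C, hC.imp_left (List.mem_append_right _), hzC⟩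
    · push Not at h2 h3
      exact hcollect (Or.inr ⟨h2, h3⟩)

/-- What the algorithm returns is the union of a list of sub-boxes of `B₀` that satisfy one of the
tests for collection, and it contains all solutions of the system `G ≤ 0` in `B₀`. -/
theorem SubdivisionReturns.exists_list [Fintype κ]
    {G : EuclideanSpace ℝ ι → EuclideanSpace ℝ κ} {B₀ : AABox ι}
    {range : AABox ι → AABox κ} (hrange : IsRangeProcedure G B₀ range) {ε : ℝ}
    {H : Set (EuclideanSpace ℝ ι)} (hH : SubdivisionReturns range ε B₀ H) :
    ∃ R : List (AABox ι), H = ⋃ B ∈ R, B.toSet ∧ (∀ B ∈ R, B.toSet ⊆ B₀.toSet) ∧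
      (∀ B ∈ R, (∀ j, (range B).hi j ≤ 0) ∨ (∀ j, (range B).lo j ≤ 0) ∧ B.diam < ε) ∧
      {z | z ∈ B₀.toSet ∧ ∀ j, G z j ≤ 0} ⊆ H := by
  obtain ⟨N, R, hN, rfl⟩ := hH
  have hinit : SubdivisionInvariant range ε B₀ {z | z ∈ B₀.toSet ∧ ∀ j, G z j ≤ 0} ([B₀], []) :=
    ⟨by simp, by simp, by simp, fun z hz => ⟨B₀, by simp, hz.1⟩⟩
  have hfinal : SubdivisionInvariant range ε B₀ {z | z ∈ B₀.toSet ∧ ∀ j, G z j ≤ 0} ([], R) := by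
    rw [← hN]
    refine Function.Iterate.rec _ hinit (fun S => SubdivisionInvariant.step ?_) N
    exact fun B hB z hz hzB j => (hrange.1 B ⟨z, hzB⟩ hB z hzB j).1.trans (hz.2 j)
  refine ⟨R, rfl, hfinal.collected_subset, hfinal.collected, fun z hz => ?_⟩
  obtain ⟨B, hB, hzB⟩ := hfinal.cover z hz
  exact mem_iUnion₂.2 ⟨B, by simpa using hB, hzB⟩

/-- For small tolerances the returned region violates the system `G ≤ 0` by little. -/
theorem SubdivisionReturns.exists_forall_le [Fintype κ]
    {G : EuclideanSpace ℝ ι → EuclideanSpace ℝ κ} {B₀ : AABox ι}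
    {range : AABox ι → AABox κ} (hrange : IsRangeProcedure G B₀ range) {δ : ℝ} (hδ : 0 < δ) :
    ∃ η > 0, ∀ ε ≤ η, ∀ H, SubdivisionReturns range ε B₀ H → ∀ z ∈ H, ∀ j, G z j ≤ δ := by
  obtain ⟨η, hη, h⟩ := hrange.2 δ hδ
  refine ⟨η, hη, fun ε hε H hH z hz j => ?_⟩
  obtain ⟨R, rfl, hsub, hR, -⟩ := hH.exists_list hrange
  obtain ⟨B, hB, hzB⟩ := mem_iUnion₂.1 hz
  have hG := hrange.1 B ⟨z, hzB⟩ (hsub B hB) z hzB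
  rcases hR B hB with hhi | ⟨hlo, hd⟩
  · exact ((hG j).2.trans (hhi j)).trans hδ.le
  · have h1 := h B ⟨z, hzB⟩ (hsub B hB) (hd.trans_le hε)
    have h2 := (range B).hi_sub_lo_le_diam ⟨_, hG⟩ j
    linarith [(hG j).2, hlo j]

end Subdivision

/-! ### The system describing the graph -/

theorem mem_graphOver_of_graphSystem_nonpos {n k r : ℕ} {xL xU : Fin n → ℝ} {tL tU : Fin k → ℝ}
    {g : Fin r → EuclideanSpace ℝ (Fin n) → ℝ} {f : Fin k → EuclideanSpace ℝ (Fin n) → ℝ}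
    {z : EuclideanSpace ℝ (Fin n ⊕ Fin k)} (hz : z ∈ (jointBox xL xU tL tU).toSet)
    (h : ∀ i, graphSystem g f z i ≤ 0) : z ∈ graphOver (feasibleSet xL xU g) f := by
  refine ⟨⟨fun i => hz (Sum.inl i), fun l => h (Sum.inl l)⟩, fun j => ?_⟩
  have h1 : tPart z j - f j (xPart z) ≤ 0 := h (Sum.inr (Sum.inl j))
  have h2 : f j (xPart z) - tPart z j ≤ 0 := h (Sum.inr (Sum.inr j))
  linarith

theorem graphOver_subset {n k r : ℕ} {xL xU : Fin n → ℝ} {tL tU : Fin k → ℝ}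
    {g : Fin r → EuclideanSpace ℝ (Fin n) → ℝ} {f : Fin k → EuclideanSpace ℝ (Fin n) → ℝ}
    (ht : ∀ x ∈ feasibleSet xL xU g, ∀ j, tL j ≤ f j x ∧ f j x ≤ tU j) :
    graphOver (feasibleSet xL xU g) f ⊆
      {z | z ∈ (jointBox xL xU tL tU).toSet ∧ ∀ i, graphSystem g f z i ≤ 0} := by
  rintro z ⟨hD, hz⟩
  constructor
  · rintro (i | j)
    · exact hD.1 i
    · have := ht _ hD j
      rwa [← hz j] at this
  · rintro (l | j | j)
    · exact hD.2 l
    · change tPart z j - f j (xPart z) ≤ 0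
      rw [hz, sub_self]
    · change f j (xPart z) - tPart z j ≤ 0
      rw [hz, sub_self]

theorem exists_lipschitzOnWith_forall {α ι : Type*} [PseudoEMetricSpace α] [Finite ι]
    {s : Set α} {F : ι → α → ℝ} (hF : ∀ i, ∃ K : ℝ≥0, LipschitzOnWith K (F i) s) :
    ∃ K : ℝ≥0, ∀ i, LipschitzOnWith K (F i) s := by
  choose K hK using hF
  obtain ⟨C, hC⟩ := (finite_range K).bddAbove
  exact ⟨C, fun i => (hK i).weaken (hC ⟨i, rfl⟩)⟩

theorem continuousOn_graphSystem {n k r : ℕ} {xL xU : Fin n → ℝ} (tL tU : Fin k → ℝ)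
    {g : Fin r → EuclideanSpace ℝ (Fin n) → ℝ} {f : Fin k → EuclideanSpace ℝ (Fin n) → ℝ}
    (hg : ∀ l, ∃ K : ℝ≥0, LipschitzOnWith K (g l) (AABox.mk xL xU).toSet)
    (hf : ∀ j, ∃ K : ℝ≥0, LipschitzOnWith K (f j) (AABox.mk xL xU).toSet)
    (i : Fin r ⊕ Fin k ⊕ Fin k) :
    ContinuousOn (fun z => graphSystem g f z i) (jointBox xL xU tL tU).toSet := by
  obtain ⟨K₁, h₁⟩ := exists_lipschitzOnWith_forall hg
  obtain ⟨K₂, h₂⟩ := exists_lipschitzOnWith_forall hf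
  exact (lipschitzOnWith_graphSystem xL xU tL tU g f (max K₁ K₂)
    (fun l => (h₁ l).weaken (le_max_left _ _)) (fun j => (h₂ j).weaken (le_max_right _ _))
    i).continuousOn

/-- On a compact set without solutions of a continuous finite system `G ≤ 0`, the violation of the
system is bounded away from zero. -/
theorem IsCompact.exists_pos_forall_exists_lt {α κ : Type*} [TopologicalSpace α] [Fintype κ]
    {K : Set α} (hK : IsCompact K) {G : α → κ → ℝ} (hG : ∀ j, ContinuousOn (fun z => G z j) K)
    (hpos : ∀ z ∈ K, ∃ j, 0 < G z j) : ∃ δ > 0, ∀ z ∈ K, ∃ j, δ < G z j := by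
  rcases K.eq_empty_or_nonempty with rfl | hne
  · exact ⟨1, one_pos, by simp⟩
  obtain ⟨y, hy, hmin⟩ := hK.exists_isMinOn (f := fun z => ∑ j, max (G z j) 0) hne
    (continuousOn_finsetSum _ fun j _ => (hG j).sup continuousOn_const)
  set p := ∑ j, max (G y j) 0 with hp
  have hp0 : 0 < p := by
    obtain ⟨j, hj⟩ := hpos y hy
    exact Finset.sum_pos' (fun _ _ => le_max_right _ _)
      ⟨j, Finset.mem_univ j, lt_max_of_lt_left hj⟩
  refine ⟨p / (Fintype.card κ + 1), by positivity, fun z hz => ?_⟩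
  by_contra! hle
  have h1 : p ≤ ∑ j, max (G z j) 0 := hmin hz
  have h2 : ∑ j, max (G z j) 0 ≤ ∑ _j : κ, p / (Fintype.card κ + 1) :=
    Finset.sum_le_sum fun j _ => max_le (hle j) (by positivity)
  rw [Finset.sum_const, Finset.card_univ, nsmul_eq_mul] at h2
  have h3 : (Fintype.card κ : ℝ) * (p / (Fintype.card κ + 1)) < p := by
    rw [← mul_div_assoc, div_lt_iff₀ (by positivity)]
    nlinarith
  linarith

/-! ### Convergence of the relaxations -/

theorem theorem3p5 {n k r m q : ℕ}
    (xL xU : Fin n → ℝ) (tL tU : Fin k → ℝ)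
    (g : Fin r → EuclideanSpace ℝ (Fin n) → ℝ)
    (f : Fin k → EuclideanSpace ℝ (Fin n) → ℝ)
    (M : Fin m → (Fin k → ℝ) → ℝ)
    (hg : ∀ l, ∃ K : ℝ≥0, LipschitzOnWith K (g l) (AABox.mk xL xU).toSet)
    (hf : ∀ j, ∃ K : ℝ≥0, LipschitzOnWith K (f j) (AABox.mk xL xU).toSet)
    (hM : ∀ i, IsMultilinear (M i))
    (ht : ∀ x ∈ feasibleSet xL xU g, ∀ j, tL j ≤ f j x ∧ f j x ≤ tU j)
    (blk : Fin n ⊕ Fin k → Fin q)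
    (hblk : Function.Injective fun j : Fin k => blk (Sum.inr j))
    (range : AABox (Fin n ⊕ Fin k) → AABox (Fin r ⊕ Fin k ⊕ Fin k))
    (hrange : IsRangeProcedure (graphSystem g f) (jointBox xL xU tL tU) range) :
    (∀ ν : ℕ, 0 < ν →
      ∃ H, SubdivisionReturns range (1 / (ν : ℝ)) (jointBox xL xU tL tU) H) ∧
    ∀ H : ℕ → Set (EuclideanSpace ℝ (Fin n ⊕ Fin k)),
      (∀ ν : ℕ, 0 < ν →
        SubdivisionReturns range (1 / (ν : ℝ)) (jointBox xL xU tL tU) (H ν)) →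
      (∀ ν : ℕ, 0 < ν →
        IsAxisAligned blk (H ν) ∧ graphOver (feasibleSet xL xU g) f ⊆ H ν) ∧
      (∀ ν : ℕ, 0 < ν →
        (liftedCorners blk M (H ν)).Finite ∧
        IsPolyhedron (convexHull ℝ (liftedCorners blk M (H ν))) ∧
        compositionGraph (feasibleSet xL xU g) f M ⊆
          convexHull ℝ (liftedCorners blk M (H ν))) ∧
      Tendsto
        (fun ν => Metric.hausdorffEDist (convexHull ℝ (liftedCorners blk M (H ν)))
          (convexHull ℝ (compositionGraph (feasibleSet xL xU g) f M)))
        atTop (𝓝 0) := by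
  refine ⟨fun ν hν => exists_subdivisionReturns range (by positivity) _, fun H hH => ?_⟩
  have hgraph : ∀ ν, 0 < ν → graphOver (feasibleSet xL xU g) f ⊆ H ν := fun ν hν => by
    obtain ⟨R, -, -, -, hsol⟩ := (hH ν hν).exists_list hrange
    exact (graphOver_subset ht).trans hsol
  have hfin : ∀ ν, 0 < ν → (liftedCorners blk M (H ν)).Finite := fun ν hν => by
    obtain ⟨R, hR, -⟩ := (hH ν hν).exists_list hrange
    rw [liftedCorners_eq_image, hR]
    exact (finite_cornerPoints_biUnion_toSet blk R).image _
  have hrelax : ∀ ν, 0 < ν → compositionGraph (feasibleSet xL xU g) f M ⊆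
      convexHull ℝ (liftedCorners blk M (H ν)) := by
    intro ν hν
    have hcomp : IsCompact (H ν) := by
      obtain ⟨R, hR, -⟩ := (hH ν hν).exists_list hrange
      rw [hR]
      exact (List.finite_toSet R).isCompact_biUnion fun B _ => B.isCompact_toSet
    rw [compositionGraph_eq_image]
    rintro _ ⟨z, hz, rfl⟩
    exact multilinearLift_mem_convexHull hM blk hblk hcomp (hfin ν hν) (hgraph ν hν hz)
  refine ⟨fun ν hν => ⟨?_, hgraph ν hν⟩,
    fun ν hν => ⟨hfin ν hν, isPolyhedron_convexHull (hfin ν hν), hrelax ν hν⟩, ?_⟩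
  · obtain ⟨R, hR, -⟩ := (hH ν hν).exists_list hrange
    rw [hR]
    exact isAxisAligned_biUnion_toSet blk R
  rw [ENNReal.tendsto_nhds_zero]
  intro e he
  obtain ⟨ρ, hρ, hρe⟩ : ∃ ρ : ℝ, 0 < ρ ∧ ENNReal.ofReal ρ ≤ e := by
    rcases eq_or_ne e ⊤ with rfl | he'
    · exact ⟨1, one_pos, le_top⟩
    · exact ⟨e.toReal, ENNReal.toReal_pos he.ne' he', (ENNReal.ofReal_toReal he').le⟩
  -- The points of the initial box whose lift is far from the graph form a compact set on which the
  -- system is violated; the algorithm avoids it for small tolerances.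
  have hK : IsCompact ((jointBox xL xU tL tU).toSet ∩ multilinearLift M ⁻¹'
      (Metric.thickening ρ (compositionGraph (feasibleSet xL xU g) f M))ᶜ) :=
    (AABox.isCompact_toSet _).inter_right
      (Metric.isOpen_thickening.isClosed_compl.preimage (continuous_multilinearLift hM))
  obtain ⟨δ, hδ, hviol⟩ := hK.exists_pos_forall_exists_lt
    (G := fun z => (graphSystem g f z).ofLp)
    (fun i => (continuousOn_graphSystem tL tU hg hf i).mono inter_subset_left) (by
      rintro z ⟨hz, hfar⟩
      by_contra! hle
      refine hfar (Metric.self_subset_thickening hρ _ ?_)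
      rw [compositionGraph_eq_image]
      exact mem_image_of_mem _ (mem_graphOver_of_graphSystem_nonpos hz hle))
  obtain ⟨η, hη, hsmall⟩ := SubdivisionReturns.exists_forall_le hrange hδ
  filter_upwards [tendsto_one_div_atTop_nhds_zero_nat.eventually_le_const hη,
    eventually_gt_atTop 0] with ν hνη hν
  have hnear : convexHull ℝ (liftedCorners blk M (H ν)) ⊆
      Metric.thickening ρ (convexHull ℝ (compositionGraph (feasibleSet xL xU g) f M)) := by
    refine convexHull_min ?_ ((convex_convexHull ℝ _).thickening ρ)
    rw [liftedCorners_eq_image]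
    rintro _ ⟨z, hz, rfl⟩
    refine Metric.thickening_subset_of_subset ρ (subset_convexHull ℝ _) ?_
    by_contra hfar
    have hzB : z ∈ (jointBox xL xU tL tU).toSet := by
      obtain ⟨R, hR, hsub, -⟩ := (hH ν hν).exists_list hrange
      have hzH := hz.1
      rw [hR] at hzH
      exact iUnion₂_subset hsub hzH
    obtain ⟨j, hj⟩ := hviol z ⟨hzB, hfar⟩
    exact (hsmall _ hνη _ (hH ν hν) z hz.1 j).not_gt hj
  refine (Metric.hausdorffEDist_le_of_mem_edist (fun w hw => ?_) fun w hw => ?_).trans hρe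
  · obtain ⟨y, hy, hwy⟩ := Metric.mem_thickening_iff.1 (hnear hw)
    exact ⟨y, hy, by rw [edist_dist]; exact ENNReal.ofReal_le_ofReal hwy.le⟩
  · exact ⟨w, convexHull_min (hrelax ν hν) (convex_convexHull ℝ _) hw, by simp⟩
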